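/- Let $p,q\ge 1$ be integers, let $\mathbb H$ be the real quaternions, and regard $\mathbb H^{p+q}$ (columns) as a right $\mathbb H$-vector space. Put $I_{p,q}=\operatorname{diag}(1,\dots,1,-1,\dots,-1)$ with $p$ entries $1$ and $q$ entries $-1$, and let $$\mathrm{Sp}(p,q)=\{g\in \mathrm{GL}_{p+q}(\mathbb H)\mid \bar g^{\,t} I_{p,q}\,g=I_{p,q}\},\qquad \mathfrak{sp}(p,q)=\{X\in \mathrm M_{p+q}(\mathbb H)\mid \bar X^{t} I_{p,q}+I_{p,q}X=0\},$$ with $\mathrm{Ad}(g)X=gXg^{-1}$. An element $X\in\mathfrak{sp}(p,q)$ is called strongly $\mathrm{Ad}_{\mathrm{Sp}(p,q)}$-real if $-X$ lies in the adjoint orbit of $X$ and moreover $-X=\mathrm{Ad}(\tau)X$ for some $\tau\in \mathrm{Sp}(p,q)$ with $\tau^2=\mathrm{Id}$. Let $X\in\mathfrak{sp}(p,q)$ be nilpotent. Then there is exactly one partition $\mathbf d=[d_1^{t_{d_1}},\dots,d_s^{t_{d_s}}]$ of $p+q$ (with $d_1>\dots>d_s>0$ and every $t_{d_i}\ge 1$)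 for which there are vectors $v^{d}_j\in\mathbb H^{p+q}$ ($d\in\{d_1,\dots,d_s\}$, $1\le j\le t_d$) such that $X^{d}v^{d}_j=0$ and the vectors $X^l v^{d}_j$ ($0\le l\le d-1$) form an $\mathbb H$-basis of $\mathbb H^{p+q}$. With this partition $\mathbf d$ of $X$, the element $X$ is strongly $\mathrm{Ad}_{\mathrm{Sp}(p,q)}$-real if and only if $t_\eta$ is even for every even part $\eta$ of $\mathbf d$. -/

import Mathlib

open scoped Matrix Quaternion

attribute [local instance 100] LieRing.ofAssociativeRing

noncomputable section

namespace QuaternionicSp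

/-- Square matrices of size `p + q` over the real quaternions; the coordinates are indexed by
`Fin p ⊕ Fin q`. They act on columns from the left. -/
abbrev Mat (p q : ℕ) : Type := Matrix (Fin p ⊕ Fin q) (Fin p ⊕ Fin q) ℍ[ℝ]

/-- The space `ℍ^(p+q)` of columns. It is regarded as a right vector space over `ℍ`,
that is, as a module over `ℍᵐᵒᵖ`, where `MulOpposite.op a • v` is the column `v a`. -/
abbrev Col (p q : ℕ) : Type := Fin p ⊕ Fin q → ℍ[ℝ]

/-- The matrix `I_{p,q} = diag (1, …, 1, -1, …, -1)`. -/
def Ipq (p q : ℕ) : Mat p q := Matrix.fromBlocks 1 0 0 (-1)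

/-- The group `Sp(p,q)` of invertible quaternionic matrices `g` with `ḡᵗ I_{p,q} g = I_{p,q}`.
(`ᴴ` is the conjugate transpose.) -/
def Sp (p q : ℕ) : Subgroup (Mat p q)ˣ where
  carrier := {g | (g : Mat p q)ᴴ * Ipq p q * (g : Mat p q) = Ipq p q}
  one_mem' := by simp
  mul_mem' := by
    intro a b ha hb
    simp only [Set.mem_ofPred_eq, Units.val_mul, Matrix.conjTranspose_mul] at ha hb ⊢
    calc (b : Mat p q)ᴴ * (a : Mat p q)ᴴ * Ipq p q * ((a : Mat p q) * (b : Mat p q))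
        = (b : Mat p q)ᴴ * ((a : Mat p q)ᴴ * Ipq p q * (a : Mat p q)) * (b : Mat p q) := by
          simp only [mul_assoc]
      _ = Ipq p q := by rw [ha, hb]
  inv_mem' := by
    intro a ha
    simp only [Set.mem_ofPred_eq] at ha ⊢
    have h1 : ((a⁻¹ : (Mat p q)ˣ) : Mat p q)ᴴ * (a : Mat p q)ᴴ = 1 := by
      rw [← Matrix.conjTranspose_mul, Units.mul_inv, Matrix.conjTranspose_one]
    calc ((a⁻¹ : (Mat p q)ˣ) : Mat p q)ᴴ * Ipq p q * ((a⁻¹ : (Mat p q)ˣ) : Mat p q)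
        = ((a⁻¹ : (Mat p q)ˣ) : Mat p q)ᴴ * ((a : Mat p q)ᴴ * Ipq p q * (a : Mat p q))
            * ((a⁻¹ : (Mat p q)ˣ) : Mat p q) := by rw [ha]
      _ = (((a⁻¹ : (Mat p q)ˣ) : Mat p q)ᴴ * (a : Mat p q)ᴴ) * Ipq p q
            * ((a : Mat p q) * ((a⁻¹ : (Mat p q)ˣ) : Mat p q)) := by simp only [mul_assoc]
      _ = Ipq p q := by rw [h1, Units.mul_inv, one_mul, mul_one]

theorem mem_Sp {p q : ℕ} {g : (Mat p q)ˣ} :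
    g ∈ Sp p q ↔ (g : Mat p q)ᴴ * Ipq p q * (g : Mat p q) = Ipq p q := Iff.rfl

/-- The real Lie algebra `𝔰𝔭(p,q)` of quaternionic matrices `X` with
`X̄ᵗ I_{p,q} + I_{p,q} X = 0`; the bracket is the commutator. -/
def sp (p q : ℕ) : LieSubalgebra ℝ (Mat p q) where
  carrier := {X | Xᴴ * Ipq p q + Ipq p q * X = 0}
  zero_mem' := by simp
  add_mem' := by
    intro X Y hX hY
    simp only [Set.mem_ofPred_eq, Matrix.conjTranspose_add, add_mul, mul_add] at hX hY ⊢
    calc Xᴴ * Ipq p q + Yᴴ * Ipq p q + (Ipq p q * X + Ipq p q * Y)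
        = (Xᴴ * Ipq p q + Ipq p q * X) + (Yᴴ * Ipq p q + Ipq p q * Y) := by abel
      _ = 0 := by rw [hX, hY, add_zero]
  smul_mem' := by
    intro c X hX
    simp only [Set.mem_ofPred_eq] at hX ⊢
    have : (c • X)ᴴ = c • Xᴴ := by
      ext1 i j
      simp only [Matrix.conjTranspose_apply, Matrix.smul_apply, Quaternion.star_smul]
    rw [this, smul_mul_assoc, mul_smul_comm, ← smul_add, hX, smul_zero]
  lie_mem' := by
    intro X Y hX hY
    change Xᴴ * Ipq p q + Ipq p q * X = 0 at hX
    change Yᴴ * Ipq p q + Ipq p q * Y = 0 at hY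
    change (X * Y - Y * X)ᴴ * Ipq p q + Ipq p q * (X * Y - Y * X) = 0
    have hX' := eq_neg_of_add_eq_zero_left hX
    have hY' := eq_neg_of_add_eq_zero_left hY
    have e1 : Yᴴ * Xᴴ * Ipq p q = Ipq p q * Y * X := by
      rw [mul_assoc, hX', mul_neg, ← mul_assoc, hY', neg_mul, neg_neg]
    have e2 : Xᴴ * Yᴴ * Ipq p q = Ipq p q * X * Y := by
      rw [mul_assoc, hY', mul_neg, ← mul_assoc, hX', neg_mul, neg_neg]
    rw [Matrix.conjTranspose_sub, Matrix.conjTranspose_mul, Matrix.conjTranspose_mul,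
      sub_mul, e1, e2, mul_sub, mul_assoc, mul_assoc]
    abel

theorem mem_sp {p q : ℕ} {X : Mat p q} :
    X ∈ sp p q ↔ Xᴴ * Ipq p q + Ipq p q * X = 0 := Iff.rfl

/-- The adjoint action `Ad(g) X = g X g⁻¹` of `Sp(p,q)` on `𝔰𝔭(p,q)`. -/
def Ad {p q : ℕ} (g : Sp p q) (X : sp p q) : sp p q :=
  ⟨((g : (Mat p q)ˣ) : Mat p q) * (X : Mat p q) * (((g : (Mat p q)ˣ)⁻¹ : (Mat p q)ˣ) : Mat p q), by
    obtain ⟨u, hu⟩ := g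
    obtain ⟨X, hX⟩ := X
    have hv := (Sp p q).inv_mem hu
    rw [mem_Sp] at hu hv
    rw [mem_sp] at hX ⊢
    have h1 : ((u⁻¹ : (Mat p q)ˣ) : Mat p q)ᴴ * (u : Mat p q)ᴴ = 1 := by
      rw [← Matrix.conjTranspose_mul, Units.mul_inv, Matrix.conjTranspose_one]
    have h2 : (u : Mat p q)ᴴ * Ipq p q = Ipq p q * ((u⁻¹ : (Mat p q)ˣ) : Mat p q) := by
      conv_rhs => rw [← hu, mul_assoc, Units.mul_inv, mul_one]
    have h3 : Ipq p q * (u : Mat p q) = ((u⁻¹ : (Mat p q)ˣ) : Mat p q)ᴴ * Ipq p q := by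
      conv_rhs => rw [← hu, mul_assoc, ← mul_assoc, h1, one_mul]
    simp only [Matrix.conjTranspose_mul]
    calc ((u⁻¹ : (Mat p q)ˣ) : Mat p q)ᴴ * (Xᴴ * (u : Mat p q)ᴴ) * Ipq p q
          + Ipq p q * ((u : Mat p q) * X * ((u⁻¹ : (Mat p q)ˣ) : Mat p q))
        = ((u⁻¹ : (Mat p q)ˣ) : Mat p q)ᴴ * (Xᴴ * ((u : Mat p q)ᴴ * Ipq p q))
          + (Ipq p q * (u : Mat p q)) * (X * ((u⁻¹ : (Mat p q)ˣ) : Mat p q)) := by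
          simp only [mul_assoc]
      _ = ((u⁻¹ : (Mat p q)ˣ) : Mat p q)ᴴ * (Xᴴ * Ipq p q + Ipq p q * X)
            * ((u⁻¹ : (Mat p q)ˣ) : Mat p q) := by
          rw [h2, h3]; simp only [mul_assoc, mul_add, add_mul]
      _ = 0 := by rw [hX, mul_zero, zero_mul]⟩

/-- The adjoint orbit `𝒪_X`. -/
def adjointOrbit {p q : ℕ} (X : sp p q) : Set (sp p q) := Set.range fun g : Sp p q => Ad g X

/-- `X` is `Ad`-real: `-X` lies in the adjoint orbit of `X`. -/
def IsAdReal {p q : ℕ} (X : sp p q) : Prop := -X ∈ adjointOrbit X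

/-- `X` is strongly `Ad`-real: it is `Ad`-real and `-X = Ad(τ) X` for some `τ ∈ Sp(p,q)`
with `τ² = 1`. -/
def IsStronglyAdReal {p q : ℕ} (X : sp p q) : Prop :=
  IsAdReal X ∧ ∃ τ : Sp p q, τ ^ 2 = 1 ∧ -X = Ad τ X

/-- `X` has Jordan partition `d`: listing the parts of `d` with multiplicity as `r₁, …, r_k`,
there are columns `v₁, …, v_k` with `X ^ rᵢ vᵢ = 0` such that the columns `X ^ l vᵢ`,
`0 ≤ l < rᵢ`, form a basis of the right `ℍ`-vector space `ℍ^(p+q)`. -/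
def HasJordanPartition {p q : ℕ} (X : Mat p q) (d : Nat.Partition (p + q)) : Prop :=
  ∃ (k : ℕ) (r : Fin k → ℕ) (v : Fin k → Col p q)
    (b : Module.Basis (Σ i : Fin k, Fin (r i)) (ℍ[ℝ])ᵐᵒᵖ (Col p q)),
    Finset.univ.val.map r = d.parts ∧
    (∀ i : Fin k, (X ^ r i) *ᵥ v i = 0) ∧
    ∀ (i : Fin k) (l : Fin (r i)), b ⟨i, l⟩ = (X ^ (l : ℕ)) *ᵥ v i

end QuaternionicSp

end

/-! With `B x y = x* I_{p,q} y`, the matrix `X` is a nilpotent map skew for a nondegenerate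
Hermitian form. The space splits orthogonally into Jordan chains on which `B` is antidiagonal
(`exists_orthogonal_jordan_basis`). The ranks of the powers of `X` recover the block sizes, which
gives uniqueness.

If an involution `τ` in the group anticommutes with `X`, then for odd `m` the map `Y = X ^ m`
exchanges the `±1` eigenspaces of `τ`. Its two restrictions are adjoint up to sign, so they have
equal rank, and `Y` has even rank (`even_colRank_pow`). For even `η`, the multiplicity `rank X^(η-1)
- 2 rank X^η + rank X^(η+1)` is therefore even.

Conversely, `X^l v ↦ (-1)^l X^l v` reverses `X` on a chain of length `r` and multiplies the form by
`(-1)^(r-1)`. This suffices for odd `r`. For even `r` the form value at the top is purely imaginary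
and can be normalized to `i`; a twist by `j` corrects the sign, as `star j * i * j = -i`, but
squares to `-1`. Swapping two equal blocks with twists `j` and `-j` gives an involution
(`exists_isometric_involution`). -/

namespace QuaternionicSp

/-! ### Orthogonal Jordan bases of skew-adjoint nilpotent maps -/

section HermitianForms

open MulOpposite

variable {V : Type*} [AddCommGroup V] [Module (ℍ[ℝ])ᵐᵒᵖ V]

/-- A Hermitian form on a right quaternionic vector space, linear in the second variable. -/
structure IsHermitianForm (B : V →+ V →+ ℍ[ℝ]) : Prop where
  smul_right : ∀ (x y : V) (a : ℍ[ℝ]), B x (op a • y) = B x y * a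
  star_apply : ∀ x y : V, star (B x y) = B y x

theorem IsHermitianForm.smul_left {B : V →+ V →+ ℍ[ℝ]} (hB : IsHermitianForm B) (x y : V)
    (a : ℍ[ℝ]) : B (op a • x) y = star a * B x y := by
  rw [← hB.star_apply, hB.smul_right, star_mul, hB.star_apply]

variable {B : V →+ V →+ ℍ[ℝ]} {T : V →ₗ[(ℍ[ℝ])ᵐᵒᵖ] V}

theorem skew_pow_apply (hT : ∀ x y, B (T x) y = -B x (T y)) (m : ℕ) (x y : V) :
    B ((T ^ m) x) y = (-1) ^ m * B x ((T ^ m) y) := by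
  induction m generalizing x y with
  | zero => simp
  | succ m ih =>
    rw [pow_succ, Module.End.mul_apply, ih, hT, ← Module.End.mul_apply, ← pow_succ',
      Module.End.mul_apply, ← Module.End.mul_apply, ← pow_succ, pow_succ (-1 : ℍ[ℝ])]
    simp

/-- A nonzero `ε`-Hermitian form, `ε = ±1`, on a right quaternionic vector space takes a nonzero
value on the diagonal. -/
theorem exists_apply_self_ne_zero {U : Submodule (ℍ[ℝ])ᵐᵒᵖ V} {A : V → V → ℍ[ℝ]} {n : ℕ}
    (hadd : ∀ x y, A (x + y) (x + y) = A x x + A x y + A y x + A y y)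
    (hsmul : ∀ x y a, A x (op a • y) = A x y * a)
    (hstar : ∀ x y, star (A x y) = (-1) ^ n * A y x)
    (hne : ∃ x ∈ U, ∃ y ∈ U, A x y ≠ 0) : ∃ v ∈ U, A v v ≠ 0 := by
  by_contra! h
  obtain ⟨x, hx, y, hy, hxy⟩ := hne
  -- A form vanishing on the diagonal is alternating. Rescaling `y` makes `A x y` an arbitrary
  -- quaternion `w`, so conjugation would be a global sign; `w = 1` and `w = i` exclude the two
  -- signs.
  have key (w : ℍ[ℝ]) : star w = -(-1) ^ n * w := by
    have hy' := U.smul_mem (op ((A x y)⁻¹ * w)) hy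
    have hw : A x (op ((A x y)⁻¹ * w) • y) = w := by
      rw [hsmul, mul_inv_cancel_left₀ hxy]
    have h0 := hadd x (op ((A x y)⁻¹ * w) • y)
    rw [h _ (U.add_mem hx hy'), h _ hx, h _ hy', hw, zero_add, add_zero] at h0
    have := hstar x (op ((A x y)⁻¹ * w) • y)
    rw [hw, eq_neg_of_add_eq_zero_right h0.symm] at this
    rw [this]; simp
  have h1 := key 1
  have h2 := key (⟨0, 1, 0, 0⟩ : ℍ[ℝ])
  rcases neg_one_pow_eq_or ℍ[ℝ] n with e | e <;> rw [e] at h1 h2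
  · have := congrArg QuaternionAlgebra.re h1
    simp at this
    norm_num at this
  · rw [neg_neg] at h2
    have h3 : (-1 : ℝ) = 1 := congrArg QuaternionAlgebra.imI (h2.trans (one_mul _))
    norm_num at h3

/-- A skew-adjoint nilpotent map has a cyclic vector `v` on every nonzero invariant nondegenerate
subspace for which `B v (T ^ m v)` is nonzero for the largest possible `m` only. -/
theorem exists_jordan_vector (hB : IsHermitianForm B) (hT : ∀ x y, B (T x) y = -B x (T y))
    (hnil : IsNilpotent T) {U : Submodule (ℍ[ℝ])ᵐᵒᵖ V} (hU : ∀ x ∈ U, T x ∈ U) (hU0 : U ≠ ⊥)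
    (hnd : ∀ x ∈ U, (∀ y ∈ U, B x y = 0) → x = 0) :
    ∃ (n : ℕ) (v : V), v ∈ U ∧ (T ^ (n + 1)) v = 0 ∧ (∀ m, m ≠ n → B v ((T ^ m) v) = 0) ∧
      B v ((T ^ n) v) ≠ 0 := by
  classical
  have hUp (m : ℕ) : ∀ x ∈ U, (T ^ m) x ∈ U := by
    induction m with
    | zero => simp
    | succ m ih => intro x hx; rw [pow_succ']; exact hU _ (ih x hx)
  obtain ⟨N, hN⟩ := hnil
  have hex : ∃ d, ∀ x ∈ U, (T ^ d) x = 0 := ⟨N, by simp [hN]⟩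
  obtain ⟨n, hn⟩ : ∃ n, Nat.find hex = n + 1 := by
    refine Nat.exists_eq_succ_of_ne_zero fun h => hU0 ?_
    have := Nat.find_spec hex
    rw [h] at this
    exact (Submodule.eq_bot_iff U).2 (by simpa using this)
  have hz : ∀ x ∈ U, (T ^ (n + 1)) x = 0 := hn ▸ Nat.find_spec hex
  have hzge (m : ℕ) (hm : n < m) : ∀ x ∈ U, (T ^ m) x = 0 := by
    intro x hx
    obtain ⟨k, rfl⟩ := Nat.exists_eq_add_of_lt hm
    rw [show n + k + 1 = k + (n + 1) by ring, pow_add, Module.End.mul_apply, hz x hx, map_zero]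
  obtain ⟨y, hy, hTy⟩ : ∃ y ∈ U, (T ^ n) y ≠ 0 := by
    have := Nat.find_min hex (m := n) (by omega)
    push Not at this
    exact this
  obtain ⟨x, hx, hxy⟩ : ∃ x ∈ U, B ((T ^ n) y) x ≠ 0 := by
    by_contra! h
    exact hTy (hnd _ (hUp n y hy) h)
  have hstar (k : ℕ) (x y : V) : star (B x ((T ^ k) y)) = (-1) ^ k * B y ((T ^ k) x) := by
    rw [hB.star_apply, skew_pow_apply hT]
  have haniso : ∃ v ∈ U, B v ((T ^ n) v) ≠ 0 := by
    refine exists_apply_self_ne_zero (A := fun x y => B x ((T ^ n) y)) (n := n) ?_ ?_ ?_ ?_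
    · intro x y
      simp only [map_add, AddMonoidHom.add_apply]
      abel
    · intro x y a
      simp only [map_smul, hB.smul_right]
    · exact hstar n
    · refine ⟨x, hx, y, hy, ?_⟩
      rw [← hB.star_apply]
      simpa using hxy
  -- The unwanted values `B v (T^k v)` are removed downward from `k = n - 1`; `j` counts the
  -- exponents already cleared.
  have hstep (j : ℕ) (hj : j ≤ n) : ∃ v ∈ U, B v ((T ^ n) v) ≠ 0 ∧
      ∀ k, n ≤ k + j → k ≠ n → B v ((T ^ k) v) = 0 := by
    induction j with
    | zero =>
      obtain ⟨v, hv, hv'⟩ := haniso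
      refine ⟨v, hv, hv', fun k hk hkn => ?_⟩
      rw [hzge k (by omega) v hv, map_zero]
    | succ j ih =>
      obtain ⟨v, hv, hc, hv'⟩ := ih (by omega)
      obtain ⟨k, hk⟩ : ∃ k, n = k + (j + 1) := ⟨n - (j + 1), by omega⟩
      set c := B v ((T ^ n) v) with hcdef
      set e := B v ((T ^ k) v) with hedef
      -- Replacing `v` by `v + T^(j+1) v a` adds two cross terms to `e`; by the symmetry of the form
      -- each equals `-e/2`. The quadratic term has exponent beyond `n` and vanishes.
      set a : ℍ[ℝ] := c⁻¹ * (-(2⁻¹ : ℝ) • e) with ha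
      have hca : c * a = -(2⁻¹ : ℝ) • e := by rw [ha, mul_inv_cancel_left₀ hc]
      have hexp (l : ℕ) : B (v + (T ^ (j + 1)) (op a • v)) ((T ^ l) (v + (T ^ (j + 1)) (op a • v)))
          = B v ((T ^ l) v) + B v ((T ^ (l + (j + 1))) v) * a
            + star a * ((-1) ^ (j + 1) * B v ((T ^ (l + (j + 1))) v))
            + star a * ((-1) ^ (j + 1) * B v ((T ^ (l + (j + 1) + (j + 1))) v)) * a := by
        simp only [map_add, AddMonoidHom.add_apply, map_smul, hB.smul_right, hB.smul_left,
          skew_pow_apply hT, ← Module.End.mul_apply, ← pow_add]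
        rw [show j + 1 + l = l + (j + 1) by ring,
          show j + 1 + (l + (j + 1)) = l + (j + 1) + (j + 1) by ring]
        abel
      have hbig (l : ℕ) (hl : n < l) : B v ((T ^ l) v) = 0 := by rw [hzge l hl v hv, map_zero]
      refine ⟨v + (T ^ (j + 1)) (op a • v), U.add_mem hv (hUp _ _ (U.smul_mem _ hv)), ?_, ?_⟩
      · rw [hexp, hbig (n + (j + 1)) (by omega), hbig (n + (j + 1) + (j + 1)) (by omega)]
        simpa using hc
      · intro l hl hln
        rw [hexp, hbig (l + (j + 1) + (j + 1)) (by omega)]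
        rcases eq_or_ne l k with rfl | hlk
        · rw [← hk, ← hcdef, ← hedef, hca]
          have h1 : star a * star c = -(2⁻¹ : ℝ) • ((-1) ^ l * e) := by
            rw [← star_mul, hca, Quaternion.star_smul, hedef, hstar]
          rw [hcdef, hstar, ← hcdef] at h1
          have h2 : star a * ((-1) ^ (j + 1) * c) = -(2⁻¹ : ℝ) • e := by
            have h3 : ((-1 : ℍ[ℝ]) ^ (j + 1) * c) = (-1) ^ l * ((-1) ^ n * c) := by
              rw [← mul_assoc, ← pow_add, show l + n = l + l + (j + 1) by omega, pow_add _ (l + l),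
                Even.neg_one_pow ⟨l, rfl⟩, one_mul]
            have hcomm : star a * (-1) ^ l = (-1) ^ l * star a :=
              ((Commute.neg_one_left (star a)).pow_left l).eq.symm
            rw [h3, ← mul_assoc, hcomm, mul_assoc, h1, mul_smul_comm, ← mul_assoc, ← pow_add,
              Even.neg_one_pow ⟨l, rfl⟩, one_mul]
          rw [h2, mul_zero, mul_zero, zero_mul, add_zero, add_assoc, ← add_smul]
          norm_num
        · rw [hbig (l + (j + 1)) (by omega), hv' l (by omega) hln]
          simp
  obtain ⟨v, hv, hc, hv'⟩ := hstep n le_rfl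
  exact ⟨n, v, hv, hz v hv, fun m hm => hv' m (by omega) hm, hc⟩

/-- The vectors `v i` generate pairwise orthogonal Jordan blocks of sizes `r i`, on each of which
the form is antidiagonal. -/
structure IsOrthogonalJordanSystem (B : V →+ V →+ ℍ[ℝ]) (T : V →ₗ[(ℍ[ℝ])ᵐᵒᵖ] V) {k : ℕ}
    (r : Fin k → ℕ) (v : Fin k → V) : Prop where
  pos : ∀ i, 0 < r i
  pow_eq_zero : ∀ i, (T ^ r i) (v i) = 0
  orthogonal : ∀ i j, i ≠ j → ∀ m, B (v i) ((T ^ m) (v j)) = 0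
  antidiagonal : ∀ i m, m + 1 ≠ r i → B (v i) ((T ^ m) (v i)) = 0
  ne_zero : ∀ i, B (v i) ((T ^ (r i - 1)) (v i)) ≠ 0

namespace IsOrthogonalJordanSystem

variable {k : ℕ} {r : Fin k → ℕ} {v : Fin k → V}

/-- Orthogonality leaves only block `i`, and antidiagonality only the term whose total exponent is
`r i - 1`; coefficients can thus be read off from the form. -/
theorem apply_sum (h : IsOrthogonalJordanSystem B T r v) (hB : IsHermitianForm B)
    (a : (Σ i : Fin k, Fin (r i)) → ℍ[ℝ]) (i : Fin k) (l : Fin (r i)) :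
    B (v i) ((T ^ (r i - 1 - l)) (∑ s, op (a s) • (T ^ (s.2 : ℕ)) (v s.1))) =
      B (v i) ((T ^ (r i - 1)) (v i)) * a ⟨i, l⟩ := by
  simp only [map_sum, map_smul, hB.smul_right, ← Module.End.mul_apply, ← pow_add]
  rw [Finset.sum_eq_single ⟨i, l⟩]
  · have := l.2
    rw [show r i - 1 - (l : ℕ) + l = r i - 1 by omega]
  · rintro ⟨j, m⟩ - hne
    rcases eq_or_ne i j with rfl | hij
    · have hlm : (l : ℕ) ≠ m := fun e => hne (by rw [Fin.ext e])
      have := l.2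
      have := m.2
      rw [h.antidiagonal _ _ (by simp only; omega), zero_mul]
    · rw [h.orthogonal _ _ hij, zero_mul]
  · simp

theorem linearIndependent (h : IsOrthogonalJordanSystem B T r v) (hB : IsHermitianForm B) :
    LinearIndependent (ℍ[ℝ])ᵐᵒᵖ
      (fun s : Σ i : Fin k, Fin (r i) => (T ^ (s.2 : ℕ)) (v s.1)) := by
  rw [Fintype.linearIndependent_iff]
  rintro g hg ⟨i, l⟩
  have := h.apply_sum hB (fun s => unop (g s)) i l
  simp only [op_unop] at this
  rw [hg, map_zero, map_zero] at this
  simpa using (mul_eq_zero.1 this.symm).resolve_left (h.ne_zero i)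

/-- The orthogonal complement of the Jordan blocks of the system. -/
def complement (hB : IsHermitianForm B) (T : V →ₗ[(ℍ[ℝ])ᵐᵒᵖ] V) (v : Fin k → V) :
    Submodule (ℍ[ℝ])ᵐᵒᵖ V where
  carrier := {x | ∀ i m, B (v i) ((T ^ m) x) = 0}
  zero_mem' := by simp
  add_mem' := by
    intro x y hx hy i m
    rw [map_add, map_add, hx, hy, add_zero]
  smul_mem' := by
    intro a x hx i m
    rw [map_smul, ← op_unop a, hB.smul_right, hx, zero_mul]

/-- Orthogonal projection onto the blocks, with the coefficients dictated by `apply_sum`. -/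
theorem exists_sub_mem_complement (h : IsOrthogonalJordanSystem B T r v) (hB : IsHermitianForm B)
    (hT : ∀ x y, B (T x) y = -B x (T y)) (x : V) :
    ∃ a : (Σ i : Fin k, Fin (r i)) → ℍ[ℝ],
      x - ∑ s, op (a s) • (T ^ (s.2 : ℕ)) (v s.1) ∈ complement hB T v := by
  refine ⟨fun s => (B (v s.1) ((T ^ (r s.1 - 1)) (v s.1)))⁻¹ *
    B (v s.1) ((T ^ (r s.1 - 1 - s.2)) x), fun i m => ?_⟩
  rcases lt_or_ge m (r i) with hm | hm
  · have := h.apply_sum hB (fun s => (B (v s.1) ((T ^ (r s.1 - 1)) (v s.1)))⁻¹ *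
      B (v s.1) ((T ^ (r s.1 - 1 - s.2)) x)) i ⟨r i - 1 - m, by omega⟩
    simp only [show r i - 1 - (r i - 1 - m) = m by omega] at this
    rw [map_sub, map_sub, this, mul_inv_cancel_left₀ (h.ne_zero i), sub_self]
  -- For `m ≥ r i`, skewness moves `T ^ m` onto `v i`, where it vanishes.
  · have h0 : (T ^ m) (v i) = 0 := by
      obtain ⟨l, rfl⟩ := Nat.exists_eq_add_of_le' hm
      rw [pow_add, Module.End.mul_apply, h.pow_eq_zero, map_zero]
    have := skew_pow_apply hT m (v i)
      (x - ∑ s : (Σ i : Fin k, Fin (r i)), op ((B (v s.1) ((T ^ (r s.1 - 1)) (v s.1)))⁻¹ *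
        B (v s.1) ((T ^ (r s.1 - 1 - s.2)) x)) • (T ^ (s.2 : ℕ)) (v s.1))
    rw [h0, map_zero, AddMonoidHom.zero_apply, eq_comm, mul_eq_zero] at this
    exact this.resolve_left (pow_ne_zero _ (by simp))

/-- The complement is `T`-invariant, and nondegenerate because it spans the space together with the
blocks. Hence `exists_jordan_vector` finds a new block inside it. -/
theorem exists_cons (h : IsOrthogonalJordanSystem B T r v) (hB : IsHermitianForm B)
    (hnd : ∀ x, (∀ y, B x y = 0) → x = 0)
    (hT : ∀ x y, B (T x) y = -B x (T y)) (hnil : IsNilpotent T)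
    (hc : complement hB T v ≠ ⊥) :
    ∃ (r' : Fin (k + 1) → ℕ) (v' : Fin (k + 1) → V), IsOrthogonalJordanSystem B T r' v' := by
  have hstar (k : ℕ) (x y : V) : star (B x ((T ^ k) y)) = (-1) ^ k * B y ((T ^ k) x) := by
    rw [hB.star_apply, skew_pow_apply hT]
  have hsymm (m : ℕ) (x y : V) (h : B x ((T ^ m) y) = 0) : B y ((T ^ m) x) = 0 := by
    have := hstar m x y
    rw [h, star_zero, eq_comm, mul_eq_zero] at this
    exact this.resolve_left (pow_ne_zero _ (by simp))
  have hU : ∀ x ∈ complement hB T v, T x ∈ complement hB T v := by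
    intro x hx i m
    have := hx i (m + 1)
    rwa [pow_succ, Module.End.mul_apply] at this
  have hnd' : ∀ x ∈ complement hB T v, (∀ y ∈ complement hB T v, B x y = 0) → x = 0 := by
    intro x hx hxy
    refine hnd x fun z => ?_
    obtain ⟨a, ha⟩ := h.exists_sub_mem_complement hB hT z
    have h1 := hxy _ ha
    rw [map_sub, sub_eq_zero] at h1
    rw [h1, map_sum]
    refine Finset.sum_eq_zero fun s _ => ?_
    rw [hB.smul_right, hsymm _ _ _ (hx s.1 s.2), zero_mul]
  obtain ⟨n, w, hw, hn, hwz, hwn⟩ := exists_jordan_vector hB hT hnil hU hc hnd'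
  refine ⟨Fin.cons (n + 1) r, Fin.cons w v, ?_, ?_, ?_, ?_, ?_⟩
  · intro i
    cases i using Fin.cases with
    | zero => simp
    | succ i => simpa using h.pos i
  · intro i
    cases i using Fin.cases with
    | zero => simpa using hn
    | succ i => simpa using h.pow_eq_zero i
  · intro i j hij m
    cases i using Fin.cases with
    | zero =>
      cases j using Fin.cases with
      | zero => exact absurd rfl hij
      | succ j => simpa using hsymm _ _ _ (hw j m)
    | succ i =>
      cases j using Fin.cases with
      | zero => simpa using hw i m
      | succ j => simpa using h.orthogonal i j (fun e => hij (by rw [e])) m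
  · intro i m hm
    cases i using Fin.cases with
    | zero =>
      simp only [Fin.cons_zero] at hm ⊢
      exact hwz m (by omega)
    | succ i => simpa using h.antidiagonal i m (by simpa using hm)
  · intro i
    cases i using Fin.cases with
    | zero => simpa using hwn
    | succ i => simpa using h.ne_zero i

end IsOrthogonalJordanSystem

/-- A skew-adjoint nilpotent map of a nondegenerate finite-dimensional quaternionic Hermitian space
has a Jordan basis made of pairwise orthogonal antidiagonal blocks. -/
theorem exists_orthogonal_jordan_basis [Module.Finite (ℍ[ℝ])ᵐᵒᵖ V] (hB : IsHermitianForm B)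
    (hnd : ∀ x, (∀ y, B x y = 0) → x = 0)
    (hT : ∀ x y, B (T x) y = -B x (T y)) (hnil : IsNilpotent T) :
    ∃ (k : ℕ) (r : Fin k → ℕ) (v : Fin k → V), IsOrthogonalJordanSystem B T r v ∧
      ⊤ ≤ Submodule.span (ℍ[ℝ])ᵐᵒᵖ
        (Set.range fun s : Σ i : Fin k, Fin (r i) => (T ^ (s.2 : ℕ)) (v s.1)) := by
  by_contra! hcon
  -- If no system spans, each can be extended, so systems with arbitrarily many blocks exist; this
  -- contradicts finite dimension.
  have hall (k : ℕ) : ∃ (r : Fin k → ℕ) (v : Fin k → V), IsOrthogonalJordanSystem B T r v := by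
    induction k with
    | zero =>
      exact ⟨Fin.elim0, Fin.elim0, fun i => i.elim0, fun i => i.elim0, fun i => i.elim0,
        fun i => i.elim0, fun i => i.elim0⟩
    | succ k ih =>
      obtain ⟨r, v, h⟩ := ih
      refine h.exists_cons hB hnd hT hnil fun hbot => hcon k r v h fun x _ => ?_
      obtain ⟨a, ha⟩ := h.exists_sub_mem_complement hB hT x
      rw [hbot, Submodule.mem_bot, sub_eq_zero] at ha
      rw [ha]
      exact Submodule.sum_mem _ fun s _ =>
        Submodule.smul_mem _ _ (Submodule.subset_span ⟨s, rfl⟩)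
  obtain ⟨r, v, h⟩ := hall (Module.finrank (ℍ[ℝ])ᵐᵒᵖ V + 1)
  have hcard := (h.linearIndependent hB).fintype_card_le_finrank
  have hsum : ∑ _i : Fin (Module.finrank (ℍ[ℝ])ᵐᵒᵖ V + 1), 1 ≤ ∑ i, r i :=
    Finset.sum_le_sum fun i _ => h.pos i
  simp at hcard hsum
  omega

end HermitianForms

/-! ### Pairing blocks of equal even size -/

theorem exists_involutive_of_even_card {α : Type*} [Fintype α] (h : Even (Fintype.card α)) :
    ∃ f : α → α, Function.Involutive f ∧ ∀ x, f x ≠ x := by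
  obtain ⟨m, hm⟩ := h
  have e : α ≃ Fin m ⊕ Fin m := Fintype.equivOfCardEq (by simp [hm])
  refine ⟨fun x => e.symm (e x).swap, fun x => by simp, fun x hx => ?_⟩
  rw [Equiv.symm_apply_eq] at hx
  generalize e x = z at hx
  cases z <;> simp at hx

theorem exists_involutive_of_even_fibers {α : Type*} [Fintype α] (r : α → ℕ)
    (h : ∀ η, Even η → Even (Fintype.card {i // r i = η})) :
    ∃ σ : α → α, Function.Involutive σ ∧ (∀ i, r (σ i) = r i) ∧
      (∀ i, Even (r i) → σ i ≠ i) ∧ ∀ i, ¬ Even (r i) → σ i = i := by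
  have hf (η : ℕ) : ∃ f : {i // r i = η} → {i // r i = η}, Function.Involutive f ∧
      (∀ x, Even η → f x ≠ x) ∧ ∀ x, ¬ Even η → f x = x := by
    by_cases hη : Even η
    · obtain ⟨f, hf, hx⟩ := exists_involutive_of_even_card (h η hη)
      exact ⟨f, hf, fun x _ => hx x, fun x hx => absurd hη hx⟩
    · exact ⟨id, fun _ => rfl, fun x hx => absurd hx hη, fun _ _ => rfl⟩
  choose f hinv heven hodd using hf
  have hval (η : ℕ) (i : α) (hi : r i = η) :
      (f (r i) ⟨i, rfl⟩ : α) = f η ⟨i, hi⟩ := by subst hi; rfl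
  refine ⟨fun i => f (r i) ⟨i, rfl⟩, fun i => ?_, fun i => (f (r i) ⟨i, rfl⟩).2,
    fun i hi e => heven _ _ hi (Subtype.ext e), fun i hi => congrArg Subtype.val (hodd _ _ hi)⟩
  dsimp only
  rw [hval (r i) _ (f (r i) ⟨i, rfl⟩).2, Subtype.coe_eta, hinv]

/-! ### Quaternion units and congruence of imaginary quaternions -/

/-- The imaginary unit `i` of the quaternions. -/
def unitI : ℍ[ℝ] := ⟨0, 1, 0, 0⟩

/-- The imaginary unit `j` of the quaternions. -/
def unitJ : ℍ[ℝ] := ⟨0, 0, 1, 0⟩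

@[simp] theorem unitI_re : unitI.re = 0 := rfl
@[simp] theorem unitI_imI : unitI.imI = 1 := rfl
@[simp] theorem unitI_imJ : unitI.imJ = 0 := rfl
@[simp] theorem unitI_imK : unitI.imK = 0 := rfl
@[simp] theorem unitJ_re : unitJ.re = 0 := rfl
@[simp] theorem unitJ_imI : unitJ.imI = 0 := rfl
@[simp] theorem unitJ_imJ : unitJ.imJ = 1 := rfl
@[simp] theorem unitJ_imK : unitJ.imK = 0 := rfl

theorem unitJ_mul_unitJ : unitJ * unitJ = -1 := by
  ext <;> simp

theorem star_unitJ : star unitJ = -unitJ := by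
  ext <;> simp

theorem unitJ_conj_unitI : unitJ * unitI * unitJ = unitI := by
  ext <;> simp

/-- Every nonzero purely imaginary quaternion is congruent to `i`. -/
theorem exists_star_mul_mul_eq_unitI {c : ℍ[ℝ]} (hc : c ≠ 0) (hstar : star c = -c) :
    ∃ x : ℍ[ℝ], x ≠ 0 ∧ star x * c * x = unitI := by
  set s : ℝ := Real.sqrt (Quaternion.normSq c) with hs
  have hs0 : 0 < s := Real.sqrt_pos.2
    (lt_of_le_of_ne Quaternion.normSq_nonneg (Quaternion.normSq_ne_zero.2 hc).symm)
  have hcc : c * c = -((s * s : ℝ) : ℍ[ℝ]) := by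
    rw [hs, Real.mul_self_sqrt Quaternion.normSq_nonneg, ← Quaternion.star_mul_self, hstar]
    simp
  have hII : unitI * unitI = -1 := by ext <;> simp
  -- Since `c² = -s²`, any `x = c y + s y i` satisfies `c x = s x i`. If this `x` vanished for `y =
  -- 1`, then `c = -s i`, and `y = j` would give `-2 s k ≠ 0`.
  obtain ⟨y, hy⟩ : ∃ y : ℍ[ℝ], c * y + s • (y * unitI) ≠ 0 := by
    by_contra! h
    have h1 := h 1
    have h2 := h unitJ
    rw [mul_one, one_mul] at h1
    rw [eq_neg_of_add_eq_zero_left h1] at h2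
    have := congrArg QuaternionAlgebra.imK h2
    simp at this
    linarith
  set x := c * y + s • (y * unitI) with hx
  have hcx : c * x = s • (x * unitI) := by
    rw [hx, mul_add, add_mul, ← mul_assoc, hcc, smul_mul_assoc, mul_assoc y, hII, mul_smul_comm,
      smul_add, ← mul_assoc, smul_smul, neg_mul, Quaternion.coe_mul_eq_smul]
    simp [add_comm]
  have hN : 0 < Quaternion.normSq x :=
    lt_of_le_of_ne Quaternion.normSq_nonneg (Quaternion.normSq_ne_zero.2 hy).symm
  have h1 : star x * c * x = (Quaternion.normSq x * s) • unitI := by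
    rw [mul_assoc, hcx, mul_smul_comm, ← mul_assoc, Quaternion.star_mul_self,
      Quaternion.coe_mul_eq_smul, smul_smul, mul_comm]
  set t := (Real.sqrt (Quaternion.normSq x * s))⁻¹ with ht
  have ht0 : t ≠ 0 := inv_ne_zero (Real.sqrt_pos.2 (by positivity)).ne'
  refine ⟨t • x, smul_ne_zero ht0 hy, ?_⟩
  rw [Quaternion.star_smul, smul_mul_assoc, smul_mul_assoc, mul_smul_comm, h1, smul_smul,
    smul_smul, ht]
  have : (√(Quaternion.normSq x * s))⁻¹ * (√(Quaternion.normSq x * s))⁻¹ *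
      (Quaternion.normSq x * s) = 1 := by
    rw [← mul_inv, Real.mul_self_sqrt (by positivity),
      inv_mul_cancel₀ (by positivity)]
  rw [this, one_smul]

/-! ### Construction of the isometric involution -/

section HermitianForms

open MulOpposite

variable {V : Type*} [AddCommGroup V] [Module (ℍ[ℝ])ᵐᵒᵖ V]
  {B : V →+ V →+ ℍ[ℝ]} {T : V →ₗ[(ℍ[ℝ])ᵐᵒᵖ] V} {k : ℕ} {r : Fin k → ℕ} {v : Fin k → V}

namespace IsOrthogonalJordanSystem

/-- The form values on the even blocks of an orthogonal Jordan system can be normalized to `i`. -/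
theorem exists_normalized (h : IsOrthogonalJordanSystem B T r v) (hB : IsHermitianForm B)
    (hT : ∀ x y, B (T x) y = -B x (T y)) :
    ∃ w : Fin k → V, IsOrthogonalJordanSystem B T r w ∧
      ∀ i, Even (r i) → B (w i) ((T ^ (r i - 1)) (w i)) = unitI := by
  have hx (i : Fin k) : ∃ x : ℍ[ℝ], x ≠ 0 ∧
      (Even (r i) → star x * B (v i) ((T ^ (r i - 1)) (v i)) * x = unitI) := by
    by_cases hi : Even (r i)
    -- The odd exponent `r i - 1` makes the top form value purely imaginary.
    · have hodd : Odd (r i - 1) := Nat.Even.sub_odd (h.pos i) hi odd_one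
      obtain ⟨x, hx, hx'⟩ := exists_star_mul_mul_eq_unitI (h.ne_zero i) (by
        rw [hB.star_apply, skew_pow_apply hT, hodd.neg_one_pow, neg_one_mul])
      exact ⟨x, hx, fun _ => hx'⟩
    · exact ⟨1, one_ne_zero, fun h => absurd h hi⟩
  choose x hx0 hx using hx
  have hval (i j : Fin k) (m : ℕ) : B (op (x i) • v i) ((T ^ m) (op (x j) • v j)) =
      star (x i) * B (v i) ((T ^ m) (v j)) * x j := by
    rw [map_smul (T ^ m), hB.smul_right, hB.smul_left]
  refine ⟨fun i => op (x i) • v i, ⟨h.pos, fun i => ?_, fun i j hij m => ?_, fun i m hm => ?_,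
    fun i => ?_⟩, fun i hi => ?_⟩
  · rw [map_smul, h.pow_eq_zero, smul_zero]
  · rw [hval, h.orthogonal i j hij, mul_zero, zero_mul]
  · rw [hval, h.antidiagonal i m hm, mul_zero, zero_mul]
  · rw [hval]
    exact mul_ne_zero (mul_ne_zero (star_ne_zero.2 (hx0 i)) (h.ne_zero i)) (hx0 i)
  · rw [hval, hx i hi]

end IsOrthogonalJordanSystem

/-- If the even Jordan blocks can be paired, a skew-adjoint nilpotent map is conjugate to its
negative by an isometric involution. -/
theorem exists_isometric_involution [Module.Finite (ℍ[ℝ])ᵐᵒᵖ V]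
    (h : IsOrthogonalJordanSystem B T r v) (hB : IsHermitianForm B)
    (hT : ∀ x y, B (T x) y = -B x (T y)) (hcard : ∑ i, r i = Module.finrank (ℍ[ℝ])ᵐᵒᵖ V)
    (heven : ∀ η, Even η → Even (Fintype.card {i // r i = η})) :
    ∃ τ : V →ₗ[(ℍ[ℝ])ᵐᵒᵖ] V, τ * τ = 1 ∧ τ * T = -(T * τ) ∧ ∀ x y, B (τ x) (τ y) = B x y := by
  obtain ⟨w, hw, hwI⟩ := h.exists_normalized hB hT
  obtain ⟨σ, hσ, hrσ, hσe, hσo⟩ := exists_involutive_of_even_fibers r heven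
  obtain ⟨b, hb⟩ : ∃ b : Module.Basis (Σ i : Fin k, Fin (r i)) (ℍ[ℝ])ᵐᵒᵖ V,
      ∀ s, b s = (T ^ (s.2 : ℕ)) (w s.1) := by
    have hli := hw.linearIndependent hB
    refine ⟨Module.Basis.mk hli
      (hli.span_eq_top_of_card_eq_finrank' (by simp [hcard])).ge, fun s => ?_⟩
    rw [Module.Basis.mk_apply]
  -- The order on indices decides which member of a pair receives `j` and which `-j`, so that the
  -- product of the two twists is `1`.
  obtain ⟨u, hu, huo, hue⟩ : ∃ u : Fin k → ℍ[ℝ], (∀ i, u (σ i) * u i = 1) ∧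
      (∀ i, ¬ Even (r i) → u i = 1) ∧ ∀ i, Even (r i) → star (u i) * unitI * u i = -unitI := by
    refine ⟨fun i => if Even (r i) then (if i < σ i then unitJ else -unitJ) else 1,
      fun i => ?_, fun i hi => by simp only [if_neg hi], fun i hi => ?_⟩
    · by_cases hi : Even (r i)
      · simp only [hrσ, hi, if_true, hσ i]
        rcases lt_or_gt_of_ne (hσe i hi) with hlt | hlt
        · simp [hlt, hlt.not_gt, unitJ_mul_unitJ]
        · simp [hlt, hlt.not_gt, unitJ_mul_unitJ]
      · simp [hrσ, hi]
    · simp only [hi, if_true]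
      split_ifs <;> simp [star_unitJ, unitJ_conj_unitI]
  have hzero (i : Fin k) (l : ℕ) (hl : r i ≤ l) : (T ^ l) (w i) = 0 := by
    obtain ⟨m, rfl⟩ := Nat.exists_eq_add_of_le' hl
    rw [pow_add, Module.End.mul_apply, hw.pow_eq_zero, map_zero]
  set τ : V →ₗ[(ℍ[ℝ])ᵐᵒᵖ] V := b.constr ℕ fun s =>
    op ((-1) ^ (s.2 : ℕ) * u s.1) • (T ^ (s.2 : ℕ)) (w (σ s.1)) with hτdef
  -- Allowing `l ≥ r i`, where both sides vanish, covers the end of a chain in the anticommutation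
  -- check.
  have hτ (i : Fin k) (l : ℕ) :
      τ ((T ^ l) (w i)) = op ((-1) ^ l * u i) • (T ^ l) (w (σ i)) := by
    rcases lt_or_ge l (r i) with hl | hl
    · have : (T ^ l) (w i) = b ⟨i, l, hl⟩ := (hb ⟨i, l, hl⟩).symm
      rw [this, hτdef, Module.Basis.constr_basis]
    · rw [hzero i l hl, hzero (σ i) l ((hrσ i).trans_le hl), map_zero, smul_zero]
  refine ⟨τ, b.ext fun s => ?_, b.ext fun s => ?_, ?_⟩
  · rw [hb, Module.End.mul_apply, hτ, map_smul, hτ, smul_smul, hσ, ← op_mul, Module.End.one_apply]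
    have : ((-1) ^ (s.2 : ℕ) * u (σ s.1)) * ((-1) ^ (s.2 : ℕ) * u s.1) = 1 := by
      rcases neg_one_pow_eq_or ℍ[ℝ] s.2 with e | e <;> rw [e] <;> simp [hu]
    rw [this, op_one, one_smul]
  · have hsucc : T ((T ^ (s.2 : ℕ)) (w s.1)) = (T ^ (s.2 + 1 : ℕ)) (w s.1) := by
      rw [pow_succ', Module.End.mul_apply]
    rw [hb, Module.End.mul_apply, LinearMap.neg_apply, Module.End.mul_apply, hsucc, hτ, hτ, map_smul, ← Module.End.mul_apply, ← pow_succ',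
      pow_succ, ← neg_smul]
    simp
  · have hbasis (s t : Σ i : Fin k, Fin (r i)) : B (τ (b s)) (τ (b t)) = B (b s) (b t) := by
      obtain ⟨i, l⟩ := s
      obtain ⟨j, m⟩ := t
      simp only [hb, hτ, hB.smul_right, hB.smul_left, skew_pow_apply hT, ← Module.End.mul_apply,
        ← pow_add]
      rcases eq_or_ne i j with rfl | hij
      · by_cases hlm : (l + m : ℕ) + 1 = r i
        · have hlm' : (l + m : ℕ) = r i - 1 := by omega
          -- The sign from `τ` on the antidiagonal: `-1` on even blocks, where the twist by `u`
          -- cancels it, and `1` on odd ones.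
          have hsign : ((-1 : ℍ[ℝ]) ^ (l : ℕ) * (-1) ^ (m : ℕ)) = (-1) ^ (r i - 1) := by
            rw [← pow_add, hlm']
          have hpull (z : ℍ[ℝ]) : star ((-1) ^ (l : ℕ) * u i) * ((-1) ^ (l : ℕ) * z) *
              ((-1) ^ (m : ℕ) * u i) =
              ((-1 : ℍ[ℝ]) ^ (l : ℕ) * ((-1 : ℍ[ℝ]) ^ (l : ℕ) * (-1) ^ (m : ℕ))) *
                (star (u i) * z * u i) := by
            rcases neg_one_pow_eq_or ℍ[ℝ] l with e | e <;>
            rcases neg_one_pow_eq_or ℍ[ℝ] m with e' | e' <;> rw [e, e'] <;> simp [mul_assoc]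
          rw [hpull, hsign, mul_assoc, hlm']
          congr 1
          by_cases hi : Even (r i)
          · have hodd : Odd (r i - 1) := Nat.Even.sub_odd (hw.pos i) hi odd_one
            rw [hwI i hi, ← hrσ i, hwI (σ i) (by rwa [hrσ]), hrσ, hue i hi, hodd.neg_one_pow]
            simp
          · have heven : Even (r i - 1) := Nat.Odd.sub_odd (Nat.not_even_iff_odd.1 hi) odd_one
            rw [hσo i hi, huo i hi, heven.neg_one_pow]
            simp
        · rw [hw.antidiagonal _ _ hlm, hw.antidiagonal _ _ (by rwa [hrσ])]
          simp
      · rw [hw.orthogonal _ _ hij, hw.orthogonal _ _ (hσ.injective.ne hij)]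
        simp
    have hspan (x : V) : x ∈ Submodule.span (ℍ[ℝ])ᵐᵒᵖ (Set.range b) := by
      rw [b.span_eq]; trivial
    intro x y
    induction hspan x using Submodule.span_induction with
    | mem x hx =>
      obtain ⟨s, rfl⟩ := hx
      induction hspan y using Submodule.span_induction with
      | mem y hy =>
        obtain ⟨t, rfl⟩ := hy
        exact hbasis s t
      | zero => simp
      | add y z _ _ hy hz => rw [map_add, map_add, map_add, hy, hz]
      | smul a y _ hy => rw [map_smul, ← op_unop a, hB.smul_right, hB.smul_right, hy]
    | zero => simp
    | add x z _ _ hx hz =>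
      rw [map_add, map_add, map_add, AddMonoidHom.add_apply, AddMonoidHom.add_apply, hx, hz]
    | smul a x _ hx => rw [map_smul, ← op_unop a, hB.smul_left, hB.smul_left, hx]

end HermitianForms

/-! ### Columns, the form of `I_{p,q}`, and quaternionic rank -/

open MulOpposite

variable {p q : ℕ}

/-- Quaternionic matrices are the right-linear endomorphisms of the space of columns. -/
noncomputable def colLin (p q : ℕ) : Mat p q ≃+* Module.End (ℍ[ℝ])ᵐᵒᵖ (Col p q) where
  toFun M :=
    { toFun := fun x => M *ᵥ x
      map_add' := Matrix.mulVec_add M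
      map_smul' := fun a x => Matrix.mulVec_smul M a x }
  invFun f := Matrix.of fun i j => f (Pi.single j 1) i
  left_inv M := by
    ext1 i j
    simp
  right_inv f := by
    refine LinearMap.ext fun x => funext fun i => ?_
    have hx : x = ∑ j, op (x j) • (Pi.single j 1 : Col p q) := by
      funext i
      simp [Finset.sum_apply, Pi.single_apply]
    conv_rhs => rw [hx, map_sum, Finset.sum_apply]
    simp [Matrix.mulVec, dotProduct]
  map_mul' M N := LinearMap.ext fun x => (Matrix.mulVec_mulVec x M N).symm
  map_add' M N := LinearMap.ext fun x => Matrix.add_mulVec M N x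

@[simp] theorem colLin_apply (M : Mat p q) (x : Col p q) : colLin p q M x = M *ᵥ x := rfl

/-- The standard basis of the space of columns. -/
noncomputable def colBasis (p q : ℕ) : Module.Basis (Fin p ⊕ Fin q) (ℍ[ℝ])ᵐᵒᵖ (Col p q) :=
  Module.Basis.ofEquivFun
    { toFun := fun x i => op (x i)
      invFun := fun x i => unop (x i)
      map_add' := fun _ _ => rfl
      map_smul' := fun _ _ => rfl
      left_inv := fun _ => rfl
      right_inv := fun _ => rfl }

instance : Module.Finite (ℍ[ℝ])ᵐᵒᵖ (Col p q) := Module.Finite.of_basis (colBasis p q)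

theorem finrank_col : Module.finrank (ℍ[ℝ])ᵐᵒᵖ (Col p q) = p + q := by
  simp [Module.finrank_eq_card_basis (colBasis p q)]

theorem Ipq_mul_Ipq : Ipq p q * Ipq p q = 1 := by
  simp [Ipq, Matrix.fromBlocks_multiply]

theorem Ipq_conjTranspose : (Ipq p q)ᴴ = Ipq p q := by
  simp [Ipq, Matrix.fromBlocks_conjTranspose]

/-- The Hermitian form with matrix `I_{p,q}`. -/
noncomputable def colForm (p q : ℕ) : Col p q →+ Col p q →+ ℍ[ℝ] :=
  AddMonoidHom.mk' (fun x => AddMonoidHom.mk' (fun y => star x ⬝ᵥ (Ipq p q *ᵥ y))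
    fun y z => by rw [Matrix.mulVec_add, dotProduct_add])
    fun x y => by
      refine DFunLike.ext _ _ fun z => ?_
      simp [add_dotProduct]

theorem colForm_apply (x y : Col p q) : colForm p q x y = star x ⬝ᵥ (Ipq p q *ᵥ y) := rfl

theorem colForm_mulVec (M : Mat p q) (x y : Col p q) :
    colForm p q (M *ᵥ x) y = star x ⬝ᵥ ((Mᴴ * Ipq p q) *ᵥ y) := by
  rw [colForm_apply, Matrix.star_mulVec, ← Matrix.dotProduct_mulVec, Matrix.mulVec_mulVec]

theorem isHermitianForm_colForm : IsHermitianForm (colForm p q) where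
  smul_right x y a := by
    rw [colForm_apply, colForm_apply, Matrix.mulVec_smul, dotProduct_smul]
    rfl
  star_apply x y := by
    rw [colForm_apply, colForm_apply, ← Matrix.star_dotProduct_star, star_star,
      Matrix.star_mulVec, ← Matrix.dotProduct_mulVec, Ipq_conjTranspose]

theorem colForm_nondegenerate (x : Col p q) (h : ∀ y, colForm p q x y = 0) : x = 0 := by
  funext i
  have := h (Ipq p q *ᵥ Pi.single i 1)
  rw [colForm_apply, Matrix.mulVec_mulVec, Ipq_mul_Ipq, Matrix.one_mulVec] at this
  simpa using this

theorem eq_of_dotProduct_mulVec_eq {M N : Mat p q}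
    (h : ∀ x y : Col p q, star x ⬝ᵥ (M *ᵥ y) = star x ⬝ᵥ (N *ᵥ y)) : M = N := by
  ext1 i j
  have := h (Pi.single i 1) (Pi.single j 1)
  simpa [← Pi.single_star] using this

/-- The rank of a quaternionic matrix, as a right-linear map. -/
noncomputable def colRank (M : Mat p q) : ℕ :=
  Module.finrank (ℍ[ℝ])ᵐᵒᵖ (LinearMap.range (colLin p q M))

theorem colRank_mul_le_left (M N : Mat p q) : colRank (M * N) ≤ colRank M := by
  unfold colRank
  rw [map_mul]
  exact Submodule.finrank_mono (LinearMap.range_comp_le_range _ _)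

theorem colRank_mul_le_right (M N : Mat p q) : colRank (M * N) ≤ colRank N := by
  unfold colRank
  rw [map_mul, Module.End.mul_eq_comp, LinearMap.range_comp]
  exact Submodule.finrank_map_le _ _

theorem eq_zero_of_star_dotProduct_self {x : Col p q} (h : star x ⬝ᵥ x = 0) : x = 0 := by
  have h1 : algebraMap ℝ ℍ[ℝ] (∑ i, Quaternion.normSq (x i)) = 0 := by
    rw [← h, map_sum]
    simp only [dotProduct, Pi.star_apply, Quaternion.star_mul_self]
    rfl
  have h2 : ∑ i, Quaternion.normSq (x i) = 0 := Quaternion.coe_injective h1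
  rw [Finset.sum_eq_zero_iff_of_nonneg fun i _ => Quaternion.normSq_nonneg] at h2
  exact funext fun i => Quaternion.normSq_eq_zero.1 (h2 i (Finset.mem_univ i))

/-- Positive definiteness of `x* x` gives `ker (M* M) = ker M`, so `rank M = rank (M* M) ≤ rank M*`.
-/
theorem colRank_le_conjTranspose (M : Mat p q) : colRank M ≤ colRank Mᴴ := by
  have hker : LinearMap.ker (colLin p q (Mᴴ * M)) = LinearMap.ker (colLin p q M) := by
    ext x
    simp only [LinearMap.mem_ker, colLin_apply]
    constructor
    · intro h
      apply eq_zero_of_star_dotProduct_self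
      rw [Matrix.star_mulVec, ← Matrix.dotProduct_mulVec, Matrix.mulVec_mulVec, h,
        dotProduct_zero]
    · intro h
      rw [← Matrix.mulVec_mulVec, h, Matrix.mulVec_zero]
  have h1 := LinearMap.finrank_range_add_finrank_ker (colLin p q M)
  have h2 := LinearMap.finrank_range_add_finrank_ker (colLin p q (Mᴴ * M))
  rw [hker, ← h1] at h2
  exact (Nat.add_right_cancel h2).symm.trans_le (colRank_mul_le_left _ _)

/-- An odd power of an element of `𝔰𝔭(p,q)` which is conjugate to its negative by an involution of
`Sp(p,q)` has even rank. -/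
theorem even_colRank_pow {X τ : Mat p q} (hX : Xᴴ * Ipq p q + Ipq p q * X = 0)
    (hτ : τᴴ * Ipq p q * τ = Ipq p q) (hττ : τ * τ = 1) (hτX : τ * X = -(X * τ)) {m : ℕ}
    (hm : Odd m) : Even (colRank (X ^ m)) := by
  have hτI : τᴴ * Ipq p q = Ipq p q * τ := by
    rw [← mul_one (τᴴ * Ipq p q), ← hττ, ← mul_assoc, hτ]
  have hXI (m : ℕ) : (Xᴴ) ^ m * Ipq p q = (-1) ^ m * (Ipq p q * X ^ m) := by
    induction m with
    | zero => simp
    | succ m ih =>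
      rw [pow_succ, mul_assoc, eq_neg_of_add_eq_zero_left hX, mul_neg, ← mul_assoc, ih,
        pow_succ, pow_succ]
      simp [mul_assoc]
  have hτXm (m : ℕ) : τ * X ^ m = (-1) ^ m * (X ^ m * τ) := by
    induction m with
    | zero => simp
    | succ m ih =>
      rw [pow_succ, ← mul_assoc, ih, mul_assoc, mul_assoc (X ^ m), hτX, pow_succ]
      simp [mul_assoc]
  have hτY := hτXm m
  have hYI := hXI m
  rw [hm.neg_one_pow, neg_one_mul] at hτY hYI
  set Y := X ^ m with hY
  have hYI' : Yᴴ * Ipq p q = -(Ipq p q * Y) := by rw [hY, Matrix.conjTranspose_pow, hYI]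
  have hA : Y * (1 + τ) = (1 - τ) * Y := by rw [mul_add, sub_mul, hτY]; simp
  have hC : Y * (1 - τ) = (1 + τ) * Y := by rw [mul_sub, add_mul, hτY]; simp [sub_eq_add_neg]
  -- `N ↦ I N* I` is the adjoint for the form; `Y` is skew and the involutive isometry `τ` is
  -- self-adjoint. So `Y (1 + τ)` and `Y (1 - τ)` are adjoint up to sign.
  have hadj1 : Y * (1 + τ) = -(Ipq p q * (Y * (1 - τ))ᴴ * Ipq p q) := by
    rw [Matrix.conjTranspose_mul, Matrix.conjTranspose_sub, Matrix.conjTranspose_one,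
      mul_assoc, mul_assoc, hYI', mul_neg, ← mul_assoc, sub_mul (1 : Mat p q), hτI, one_mul,
      ← mul_one_sub, mul_neg, neg_neg, ← mul_assoc, ← mul_assoc, Ipq_mul_Ipq, one_mul, hA]
  have hadj2 : Y * (1 - τ) = -(Ipq p q * (Y * (1 + τ))ᴴ * Ipq p q) := by
    rw [Matrix.conjTranspose_mul, Matrix.conjTranspose_add, Matrix.conjTranspose_one,
      mul_assoc, mul_assoc, hYI', mul_neg, ← mul_assoc, add_mul (1 : Mat p q), hτI, one_mul,
      ← mul_one_add, mul_neg, neg_neg, ← mul_assoc, ← mul_assoc, Ipq_mul_Ipq, one_mul, hC]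
  have hle (M N : Mat p q) (h : M = -(Ipq p q * Nᴴ * Ipq p q)) : colRank M ≤ colRank N := by
    rw [h, ← mul_neg]
    have := colRank_le_conjTranspose Nᴴ
    rw [Matrix.conjTranspose_conjTranspose] at this
    exact (colRank_mul_le_left _ _).trans ((colRank_mul_le_right _ _).trans this)
  have heq : colRank (Y * (1 + τ)) = colRank (Y * (1 - τ)) :=
    le_antisymm (hle _ _ hadj1) (hle _ _ hadj2)
  have hsup : LinearMap.range (colLin p q (Y * (1 + τ))) ⊔
      LinearMap.range (colLin p q (Y * (1 - τ))) = LinearMap.range (colLin p q Y) := by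
    refine le_antisymm (sup_le ?_ ?_) ?_
    · rw [map_mul]; exact LinearMap.range_comp_le_range _ _
    · rw [map_mul]; exact LinearMap.range_comp_le_range _ _
    · rintro _ ⟨x, rfl⟩
      refine Submodule.mem_sup.2 ⟨_, ⟨(2⁻¹ : ℝ) • x, rfl⟩, _, ⟨(2⁻¹ : ℝ) • x, rfl⟩, ?_⟩
      rw [colLin_apply, colLin_apply, ← Matrix.add_mulVec, ← mul_add]
      have h2 : (1 + τ + (1 - τ)) *ᵥ ((2⁻¹ : ℝ) • x) = x := by
        rw [add_add_sub_cancel, Matrix.add_mulVec, Matrix.one_mulVec, ← add_smul]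
        norm_num
      rw [← Matrix.mulVec_mulVec, h2, colLin_apply]
  -- The two ranges lie in the `-1` and `+1` eigenspaces of `τ`.
  have hinf : LinearMap.range (colLin p q (Y * (1 + τ))) ⊓
      LinearMap.range (colLin p q (Y * (1 - τ))) = ⊥ := by
    rw [Submodule.eq_bot_iff]
    rintro z ⟨⟨x, hx⟩, ⟨y, hy⟩⟩
    rw [colLin_apply, hA] at hx
    rw [colLin_apply, hC] at hy
    have h1 : τ *ᵥ z = -z := by
      rw [← hx, Matrix.mulVec_mulVec, ← mul_assoc, mul_sub, hττ, mul_one, ← Matrix.neg_mulVec,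
        ← neg_mul, neg_sub]
    have h2 : τ *ᵥ z = z := by
      rw [← hy, Matrix.mulVec_mulVec, ← mul_assoc, mul_add, hττ, mul_one, add_comm]
    have h3 : z + z = 0 := by
      nth_rewrite 1 [← h2]
      rw [h1, neg_add_cancel]
    rw [← inv_smul_smul₀ (two_ne_zero' ℝ) z, two_smul, h3, smul_zero]
  have hdim := Submodule.finrank_sup_add_finrank_inf_eq
    (LinearMap.range (colLin p q (Y * (1 + τ)))) (LinearMap.range (colLin p q (Y * (1 - τ))))
  rw [hsup, hinf, finrank_bot, add_zero] at hdim
  refine ⟨colRank (Y * (1 - τ)), ?_⟩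
  change _ = colRank _ + colRank _ at hdim
  rw [heq] at hdim
  exact hdim

/-! ### Block multiplicities from ranks of powers -/

/-- `X ^ m` shifts each chain by `m`, so its range has as basis the chain vectors of index at least
`m`; truncated subtraction accounts for blocks shorter than `m`. -/
theorem HasJordanPartition.colRank_pow {X : Mat p q} {d : Nat.Partition (p + q)}
    (h : HasJordanPartition X d) (m : ℕ) :
    colRank (X ^ m) = (d.parts.map fun x => x - m).sum := by
  obtain ⟨k, r, v, b, hd, hv, hb⟩ := h
  have hrange : LinearMap.range (colLin p q (X ^ m)) = Submodule.span (ℍ[ℝ])ᵐᵒᵖ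
      (Set.range fun s : Σ i : Fin k, Fin (r i - m) =>
        b ⟨s.1, s.2 + m, by have := s.2.2; omega⟩) := by
    rw [LinearMap.range_eq_map, ← b.span_eq, Submodule.map_span]
    refine le_antisymm (Submodule.span_le.2 ?_) (Submodule.span_le.2 ?_)
    · rintro _ ⟨_, ⟨⟨i, l⟩, rfl⟩, rfl⟩
      rw [colLin_apply, hb, Matrix.mulVec_mulVec, ← pow_add]
      by_cases hl : m + l < r i
      · refine Submodule.subset_span ⟨⟨i, l, by omega⟩, ?_⟩
        simp only [hb, add_comm m]
      · obtain ⟨n, hn⟩ := Nat.exists_eq_add_of_le' (not_lt.1 hl)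
        rw [hn, pow_add, ← Matrix.mulVec_mulVec, hv, Matrix.mulVec_zero]
        exact Submodule.zero_mem _
    · rintro _ ⟨⟨i, l⟩, rfl⟩
      refine Submodule.subset_span ⟨_, ⟨⟨i, l, by have := l.2; omega⟩, rfl⟩, ?_⟩
      dsimp only
      rw [colLin_apply, hb, hb, Matrix.mulVec_mulVec, ← pow_add]
      simp only [add_comm m]
  have hli : LinearIndependent (ℍ[ℝ])ᵐᵒᵖ (fun s : Σ i : Fin k, Fin (r i - m) =>
      b ⟨s.1, s.2 + m, by have := s.2.2; omega⟩) := by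
    refine b.linearIndependent.comp (fun s : Σ i : Fin k, Fin (r i - m) =>
      (⟨s.1, s.2 + m, by have := s.2.2; omega⟩ : Σ i : Fin k, Fin (r i))) ?_
    rintro ⟨i, l⟩ ⟨j, n⟩ h
    obtain ⟨rfl, h⟩ := Sigma.mk.inj_iff.1 h
    have := congrArg Fin.val (eq_of_heq h)
    simp only [add_left_inj] at this
    rw [Fin.ext this]
  rw [colRank, hrange, finrank_span_eq_card hli, ← hd, Multiset.map_map, Fintype.card_sigma]
  simp only [Fintype.card_fin]
  rfl

/-- The second difference in `n` of the truncated `x - n` is the indicator of `x = n + 1`. -/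
theorem sum_tsub_add_sum_tsub (s : Multiset ℕ) (n : ℕ) :
    (s.map fun x => x - n).sum + (s.map fun x => x - (n + 2)).sum =
      2 * (s.map fun x => x - (n + 1)).sum + s.count (n + 1) := by
  induction s using Multiset.induction_on with
  | empty => simp
  | cons a s ih =>
    simp only [Multiset.map_cons, Multiset.sum_cons, Multiset.count_cons]
    split_ifs <;> omega

theorem HasJordanPartition.unique {X : Mat p q} {d e : Nat.Partition (p + q)}
    (hd : HasJordanPartition X d) (he : HasJordanPartition X e) : d = e := by
  refine Nat.Partition.ext (Multiset.ext.2 fun n => ?_)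
  rcases n with _ | n
  · rw [Multiset.count_eq_zero.2 fun h => (d.parts_pos h).ne rfl,
      Multiset.count_eq_zero.2 fun h => (e.parts_pos h).ne rfl]
  · have h1 := sum_tsub_add_sum_tsub d.parts n
    have h2 := sum_tsub_add_sum_tsub e.parts n
    rw [← hd.colRank_pow, ← hd.colRank_pow, ← hd.colRank_pow] at h1
    rw [← he.colRank_pow, ← he.colRank_pow, ← he.colRank_pow] at h2
    omega

theorem HasJordanPartition.even_count {X : sp p q} {d : Nat.Partition (p + q)}
    (hd : HasJordanPartition (X : Mat p q) d) (hX : IsStronglyAdReal X) {η : ℕ} (hη : Even η) :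
    Even (d.parts.count η) := by
  obtain ⟨-, τ, hτ, hτX⟩ := hX
  have hττ : ((τ : (Mat p q)ˣ) : Mat p q) * ((τ : (Mat p q)ˣ) : Mat p q) = 1 := by
    rw [← sq]
    exact congrArg (fun g : Sp p q => ((g : (Mat p q)ˣ) : Mat p q)) hτ
  have hconj : -(X : Mat p q) = ((τ : (Mat p q)ˣ) : Mat p q) * (X : Mat p q) *
      (((τ : (Mat p q)ˣ)⁻¹ : (Mat p q)ˣ) : Mat p q) :=
    congrArg (fun Y : sp p q => (Y : Mat p q)) hτX
  have hanti : ((τ : (Mat p q)ˣ) : Mat p q) * (X : Mat p q) =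
      -((X : Mat p q) * ((τ : (Mat p q)ˣ) : Mat p q)) := by
    rw [← neg_mul, hconj, Units.inv_mul_cancel_right]
  have heven {m : ℕ} (hm : Odd m) : Even (colRank ((X : Mat p q) ^ m)) :=
    even_colRank_pow X.2 τ.2 hττ hanti hm
  rcases η with _ | n
  · rw [Multiset.count_eq_zero.2 fun h => (d.parts_pos h).ne rfl]
    exact Even.zero
  · have hn : Odd n := by rwa [Nat.even_add_one, Nat.not_even_iff_odd] at hη
    have h1 := sum_tsub_add_sum_tsub d.parts n
    rw [← hd.colRank_pow, ← hd.colRank_pow, ← hd.colRank_pow] at h1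
    obtain ⟨a, ha⟩ := heven hn
    obtain ⟨c, hc⟩ := heven (hn.add_even even_two)
    -- The exponents `n` and `n + 2` are odd, so their ranks are `2a` and `2c`; the rank at `n + 1`
    -- already enters doubled.
    exact ⟨a + c - colRank ((X : Mat p q) ^ (n + 1)), by omega⟩

theorem colForm_skew {X : Mat p q} (hX : Xᴴ * Ipq p q + Ipq p q * X = 0) (x y : Col p q) :
    colForm p q (colLin p q X x) y = -colForm p q x (colLin p q X y) := by
  rw [colLin_apply, colLin_apply, colForm_mulVec, colForm_apply,
    eq_neg_of_add_eq_zero_left hX, Matrix.neg_mulVec, dotProduct_neg, Matrix.mulVec_mulVec]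

theorem isStronglyAdReal_of_involution {X : sp p q}
    {f : Col p q →ₗ[(ℍ[ℝ])ᵐᵒᵖ] Col p q} (hff : f * f = 1)
    (hfX : f * colLin p q X = -(colLin p q X * f))
    (hf : ∀ x y, colForm p q (f x) (f y) = colForm p q x y) : IsStronglyAdReal X := by
  obtain ⟨M, rfl⟩ := (colLin p q).surjective f
  have hMM : M * M = 1 := (colLin p q).injective (by rw [map_mul, hff, map_one])
  have hMX : M * (X : Mat p q) = -((X : Mat p q) * M) :=
    (colLin p q).injective (by rw [map_mul, hfX, map_neg, map_mul])
  have hM : Mᴴ * Ipq p q * M = Ipq p q := by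
    refine eq_of_dotProduct_mulVec_eq fun x y => ?_
    rw [← colForm_apply, ← hf, colLin_apply, colForm_mulVec, colLin_apply, Matrix.mulVec_mulVec]
  let τ : Sp p q := ⟨⟨M, M, hMM, hMM⟩, hM⟩
  have hτ : -X = Ad τ X := by
    refine Subtype.ext ?_
    change -(X : Mat p q) = M * (X : Mat p q) * M
    rw [hMX, neg_mul, mul_assoc, hMM, mul_one]
  refine ⟨⟨τ, hτ.symm⟩, τ, ?_, hτ⟩
  rw [sq]
  exact Subtype.ext (Units.ext hMM)

end QuaternionicSp

/-! ### The main theorem -/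

theorem mainTheorem8 (p q : ℕ) (hp : 0 < p) (hq : 0 < q) (X : QuaternionicSp.sp p q)
    (hX : IsNilpotent (X : QuaternionicSp.Mat p q)) :
    (∃! d : Nat.Partition (p + q),
      QuaternionicSp.HasJordanPartition (X : QuaternionicSp.Mat p q) d) ∧
    ∀ d : Nat.Partition (p + q),
      QuaternionicSp.HasJordanPartition (X : QuaternionicSp.Mat p q) d →
        (QuaternionicSp.IsStronglyAdReal X ↔
          ∀ η ∈ d.parts, Even η → Even (d.parts.count η)) := by
  open QuaternionicSp in
  have hskew := colForm_skew (X := (X : Mat p q)) X.2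
  obtain ⟨k, r, v, h, hspan⟩ := exists_orthogonal_jordan_basis isHermitianForm_colForm
    colForm_nondegenerate hskew (hX.map (colLin p q))
  have hli := h.linearIndependent isHermitianForm_colForm
  have hcard : ∑ i, r i = Module.finrank (ℍ[ℝ])ᵐᵒᵖ (Col p q) := by
    simp [Module.finrank_eq_card_basis (Module.Basis.mk hli hspan)]
  let d : Nat.Partition (p + q) :=
    { parts := Finset.univ.val.map r
      parts_pos := by
        intro n hn
        obtain ⟨i, -, rfl⟩ := Multiset.mem_map.1 hn
        exact h.pos i
      parts_sum := hcard.trans finrank_col }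
  have hd : HasJordanPartition (X : Mat p q) d := by
    refine ⟨k, r, v, Module.Basis.mk hli hspan, rfl, fun i => ?_, fun i l => ?_⟩
    · rw [← colLin_apply, map_pow, h.pow_eq_zero]
    · rw [Module.Basis.mk_apply, ← colLin_apply, map_pow]
  refine ⟨⟨d, hd, fun e he => he.unique hd⟩, fun e he => ?_⟩
  -- By uniqueness, any Jordan partition is the one read off from the orthogonal Jordan basis.
  rw [he.unique hd]
  refine ⟨fun hreal η _ hη => hd.even_count hreal hη, fun heven => ?_⟩
  obtain ⟨f, hff, hfX, hf⟩ := exists_isometric_involution h isHermitianForm_colForm hskew hcard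
    fun η hη => by
      have hcount : d.parts.count η = Fintype.card {i // r i = η} := by
        rw [Multiset.count_map, Fintype.card_subtype]
        simp only [eq_comm (a := η)]
        rfl
      rw [← hcount]
      by_cases hmem : η ∈ d.parts
      · exact heven η hmem hη
      · rw [Multiset.count_eq_zero.2 hmem]
        exact Even.zero
  exact isStronglyAdReal_of_involution hff hfX hf
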